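/- Let $\psi=\Gamma'/\Gamma$ be the digamma function and let the Stieltjes constants $\gamma_n$ be defined by the Laurent expansion $\zeta(s)=\frac{1}{s-1}+\sum_{n=0}^\infty\frac{(-1)^n}{n!}\gamma_n(s-1)^n$ of the Riemann zeta function about $s=1$. For every integer $j\ge 0$ the function $u\mapsto\left[\psi'(1+u)-\frac{1}{1+u}\right]\log^j u$ is integrable on $(0,\infty)$, and for every integer $n\ge 1$ $$(-1)^{n-1}\,n\,\gamma_{n-1}=\frac{d^n}{ds^n}\big[(s-1)\zeta(s)\big]\Big|_{s=1}=\sum_{j=0}^{n}\binom{n}{j}\pi^{\,n-j-1}\sin\!\left(\frac{(n-j)\pi}{2}\right)\int_0^\infty\left[\psi'(1+u)-\frac{1}{1+u}\right](-1)^j\log^j u\,du ,$$ where $(s-1)\zeta(s)$ is given its limiting value $1$ at $s=1$. -/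

import Mathlib

open Set MeasureTheory
open scoped Nat

/-- The Stieltjes constant `γₙ`: `(-1)ⁿ / n! * γₙ` is the coefficient of `(s - 1)ⁿ` in the Laurent
expansion of `ζ` about `s = 1`. Mathlib's `riemannZeta₀` is the entire function that equals
`ζ(s) - 1 / (s - 1)` for `s ≠ 1`, so its Taylor coefficients at `1` are these coefficients. -/
noncomputable def stieltjesConstant (n : ℕ) : ℂ :=
  (-1) ^ n * iteratedDeriv n riemannZeta₀ 1

/-- The Laurent expansion that characterizes the Stieltjes constants. -/
theorem hasSum_stieltjesConstant {s : ℂ} (hs : s ≠ 1) :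
    HasSum (fun n : ℕ => (-1 : ℂ) ^ n / (n ! : ℂ) * stieltjesConstant n * (s - 1) ^ n)
      (riemannZeta s - 1 / (s - 1)) := by
  have h := Complex.hasSum_taylorSeries_of_entire differentiable_riemannZeta₀ 1 s
  have e : riemannZeta₀ s = riemannZeta s - 1 / (s - 1) := by
    rw [riemannZeta_eq_inv_sub_add hs, one_div]; ring
  rw [e] at h
  refine h.congr_fun fun n => ?_
  have h1 : ((-1 : ℂ) ^ n) * (-1) ^ n = 1 := by rw [← mul_pow]; simp
  simp only [stieltjesConstant, smul_eq_mul, div_eq_mul_inv]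
  linear_combination ((n ! : ℂ)⁻¹ * iteratedDeriv n riemannZeta₀ 1 * (s - 1) ^ n) * h1

/-- The kernel `ψ'(1 + u) - 1 / (1 + u)`, where `ψ = Γ' / Γ` is the digamma function. -/
noncomputable def trigammaKernel (u : ℝ) : ℂ :=
  deriv Complex.digamma (1 + (u : ℂ)) - 1 / (1 + (u : ℂ))

/-- The integrand `[ψ'(1 + u) - 1 / (1 + u)] (-1)ʲ logʲ u`. -/
noncomputable def logMomentIntegrand (j : ℕ) (u : ℝ) : ℂ :=
  trigammaKernel u * ((-1) ^ j * (Real.log u : ℂ) ^ j)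

/-- `∑ⱼ₌₀ⁿ C(n, j) π^(n-j-1) sin((n-j)π/2) ∫₀^∞ [ψ'(1 + u) - 1 / (1 + u)] (-1)ʲ logʲ u du`.
The exponent `n - j - 1` is an integer, equal to `-1` for `j = n`. -/
noncomputable def logMomentSum (n : ℕ) : ℂ :=
  ∑ j ∈ Finset.range (n + 1),
    (n.choose j : ℂ) * (Real.pi : ℂ) ^ ((n : ℤ) - (j : ℤ) - 1)
      * Complex.sin (((n : ℂ) - (j : ℂ)) * (Real.pi : ℂ) / 2)
      * ∫ u in Ioi (0 : ℝ), logMomentIntegrand j u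

/-! Let K(u) = ψ'(1+u) - 1/(1+u). For 0 < w < 1, expand ψ'(1+u) = ∑ (1+u+k)⁻²
(`deriv_digamma_ofReal`) and integrate against u^(-w) term by term. Beta integrals give (π / sin πw)
w ζ(1+w) for the series and π / sin πw for 1/(1+u), so that w ζ(1+w) = 1 + (sin πw / π) ∫ u^(-w)
K(u) du (`mellin_trigammaKernel_ofReal`). The two pieces need 0 < w < 1, but 0 ≤ K(u) ≤ (1+u)⁻²
makes the integral of K holomorphic for -1 < Re w < 1. By the identity theorem the formula holds on
that strip, hence near w = 0 (`riemannZeta₁_one_add_eqOn`). There the Leibniz rule gives the result: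
derivatives of u^(-w) produce (-log u)^j, and those of sin πw produce π^m sin(mπ/2). -/

/-! ### Series for digamma and trigamma on the real axis -/

theorem differentiableAt_realGamma_of_pos {x : ℝ} (hx : 0 < x) :
    DifferentiableAt ℝ Real.Gamma x :=
  Real.differentiableAt_Gamma fun m => by
    have : (0 : ℝ) ≤ m := m.cast_nonneg
    linarith

/-- The logarithmic derivative of the real Gamma function. -/
theorem hasDerivAt_log_Gamma {x : ℝ} (hx : 0 < x) :
    HasDerivAt (Real.log ∘ Real.Gamma) (deriv Real.Gamma x / Real.Gamma x) x :=
  (differentiableAt_realGamma_of_pos hx).hasDerivAt.log (Real.Gamma_pos_of_pos hx).ne'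

theorem ofReal_ne_neg_natCast {x : ℝ} (hx : 0 < x) (m : ℕ) : (x : ℂ) ≠ -m := by
  intro h
  have := congrArg Complex.re h
  simp at this
  have h2 : (0 : ℝ) ≤ m := m.cast_nonneg
  linarith

theorem digamma_ofReal {x : ℝ} (hx : 0 < x) :
    Complex.digamma x = ((deriv Real.Gamma x / Real.Gamma x : ℝ) : ℂ) := by
  have h1 : HasDerivAt (fun y : ℝ => ((Real.Gamma y : ℝ) : ℂ)) (deriv Complex.Gamma x) x := by
    have := (Complex.differentiableAt_Gamma x (ofReal_ne_neg_natCast hx)).hasDerivAt.comp_ofReal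
    simpa only [Complex.Gamma_ofReal] using this
  have h2 := (differentiableAt_realGamma_of_pos hx).hasDerivAt.ofReal_comp
  rw [Complex.digamma_def, logDeriv_apply, h1.unique h2, Complex.Gamma_ofReal]
  push_cast
  rfl

theorem ofReal_re_digamma {x : ℝ} (hx : 0 < x) :
    (((Complex.digamma x).re : ℝ) : ℂ) = Complex.digamma x := by
  rw [digamma_ofReal hx, Complex.ofReal_re]

/-- Log-convexity of Γ: ψ is the derivative of a convex function. -/
theorem re_digamma_monotoneOn : MonotoneOn (fun x : ℝ => (Complex.digamma x).re) (Ioi 0) := by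
  have h := Real.convexOn_log_Gamma.monotoneOn_deriv
    (fun x hx => (hasDerivAt_log_Gamma hx).differentiableAt)
  intro x hx y hy hxy
  have := h hx hy hxy
  rw [(hasDerivAt_log_Gamma hx).deriv, (hasDerivAt_log_Gamma hy).deriv] at this
  simpa only [digamma_ofReal hx, digamma_ofReal hy, Complex.ofReal_re] using this

theorem re_digamma_add_one {x : ℝ} (hx : 0 < x) :
    (Complex.digamma ((x + 1 : ℝ) : ℂ)).re = (Complex.digamma x).re + 1 / x := by
  have := Complex.digamma_apply_add_one x (ofReal_ne_neg_natCast hx)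
  push_cast
  rw [this, Complex.add_re, ← Complex.ofReal_inv, Complex.ofReal_re, one_div]

theorem re_digamma_add_nat {x : ℝ} (hx : 0 < x) (n : ℕ) :
    (Complex.digamma ((x + n : ℝ) : ℂ)).re
      = (Complex.digamma x).re + ∑ k ∈ Finset.range n, 1 / (x + k) := by
  induction n with
  | zero => simp
  | succ n ih =>
    have := re_digamma_add_one (x := x + n) (by positivity)
    rw [Finset.sum_range_succ, ← add_assoc, ← ih, ← this]
    push_cast
    ring_nf

/-- The recurrence telescopes the partial sums, leaving the error ψ(x+n) - ψ(1+n). Monotonicity of ψ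
traps it between 0 and ψ(1+n+m) - ψ(1+n) ≤ m/(n+1), for an integer m ≥ x. -/
theorem hasSum_digamma_sub {x : ℝ} (hx : 1 ≤ x) :
    HasSum (fun k : ℕ => 1 / (1 + (k : ℝ)) - 1 / (x + k))
      ((Complex.digamma x).re - (Complex.digamma (1 : ℝ)).re) := by
  have hx0 : 0 < x := by linarith
  rw [hasSum_iff_tendsto_nat_of_nonneg]
  · have hs (n : ℕ) : ∑ k ∈ Finset.range n, (1 / (1 + (k : ℝ)) - 1 / (x + k))
        = (Complex.digamma x).re - (Complex.digamma (1 : ℝ)).re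
          - ((Complex.digamma ((x + n : ℝ) : ℂ)).re
            - (Complex.digamma ((1 + n : ℝ) : ℂ)).re) := by
      rw [re_digamma_add_nat hx0, re_digamma_add_nat one_pos, Finset.sum_sub_distrib]
      ring
    simp_rw [hs]
    conv => enter [3, 1]; rw [← sub_zero ((Complex.digamma x).re - _)]
    refine tendsto_const_nhds.sub ?_
    obtain ⟨m, hm⟩ := exists_nat_ge x
    have hlim : Filter.Tendsto (fun n : ℕ => (m : ℝ) * (1 / ((n : ℝ) + 1))) Filter.atTop
        (nhds 0) := by
      simpa using (tendsto_one_div_add_atTop_nhds_zero_nat (𝕜 := ℝ)).const_mul (m : ℝ)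
    refine tendsto_of_tendsto_of_tendsto_of_le_of_le tendsto_const_nhds hlim ?_ ?_
    · intro n
      have hn : (0 : ℝ) ≤ n := n.cast_nonneg
      exact sub_nonneg.2 (re_digamma_monotoneOn (show (0 : ℝ) < 1 + n by positivity)
        (show (0 : ℝ) < x + n by positivity) (by linarith))
    · intro n
      have hn : (0 : ℝ) ≤ n := n.cast_nonneg
      have h1 := re_digamma_monotoneOn (show (0 : ℝ) < x + n by positivity)
        (show (0 : ℝ) < 1 + n + m by positivity) (by linarith)
      have h2 := re_digamma_add_nat (show (0 : ℝ) < 1 + n by positivity) m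
      have h3 : ∑ k ∈ Finset.range m, 1 / ((1 : ℝ) + n + k) ≤ m * (1 / ((n : ℝ) + 1)) := by
        calc _ ≤ ∑ k ∈ Finset.range m, 1 / ((n : ℝ) + 1) := by
              refine Finset.sum_le_sum fun k _ => ?_
              have hk : (0 : ℝ) ≤ k := k.cast_nonneg
              exact one_div_le_one_div_of_le (by positivity) (by linarith)
          _ = _ := by simp
      simp only at h1
      linarith
  · intro k
    have hk : (0 : ℝ) ≤ k := k.cast_nonneg
    exact sub_nonneg.2 (one_div_le_one_div_of_le (by positivity) (by linarith))

theorem summable_one_div_add_one_sq : Summable (fun k : ℕ => 1 / (1 + (k : ℝ)) ^ 2) := by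
  have := (summable_nat_add_iff 1).2 (Real.summable_one_div_nat_pow.2 (le_refl 2))
  simpa [add_comm] using this

theorem one_div_add_sq_le {x : ℝ} (hx : 1 ≤ x) (k : ℕ) :
    1 / (x + k) ^ 2 ≤ 1 / (1 + (k : ℝ)) ^ 2 := by
  have hk : (0 : ℝ) ≤ k := k.cast_nonneg
  gcongr

theorem summable_one_div_add_sq {x : ℝ} (hx : 1 ≤ x) :
    Summable (fun k : ℕ => 1 / (x + k) ^ 2) :=
  summable_one_div_add_one_sq.of_nonneg_of_le (fun _ => by positivity) (one_div_add_sq_le hx)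

theorem deriv_digamma_ofReal {x : ℝ} (hx : 1 < x) :
    deriv Complex.digamma x = ((∑' k : ℕ, 1 / (x + k) ^ 2 : ℝ) : ℂ) := by
  have hx0 : 0 < x := by linarith
  have hser : HasDerivAt (fun y : ℝ => ∑' k : ℕ, (1 / (1 + (k : ℝ)) - 1 / (y + k)))
      (∑' k : ℕ, 1 / (x + k) ^ 2) x := by
    have hterm (k : ℕ) (y : ℝ) (hy : y ∈ Ioi (1 : ℝ)) :
        HasDerivAt (fun y : ℝ => 1 / (1 + (k : ℝ)) - 1 / (y + k)) (1 / (y + k) ^ 2) y := by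
      have hk : (0 : ℝ) ≤ k := k.cast_nonneg
      have hne : y + k ≠ 0 := by have : 1 < y := hy; positivity
      have h := (((hasDerivAt_id y).add_const (k : ℝ)).fun_inv hne).const_sub (1 / (1 + (k : ℝ)))
      simpa only [one_div, neg_div, neg_neg, id] using h
    have hbound (k : ℕ) (y : ℝ) (hy : y ∈ Ioi (1 : ℝ)) :
        ‖1 / (y + k) ^ 2‖ ≤ 1 / (1 + (k : ℝ)) ^ 2 := by
      rw [Real.norm_of_nonneg (by positivity)]
      exact one_div_add_sq_le (le_of_lt hy) k
    exact hasDerivAt_tsum_of_isPreconnected summable_one_div_add_one_sq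
      isOpen_Ioi isPreconnected_Ioi hterm hbound hx (hasSum_digamma_sub hx.le).summable hx
  have hreal : HasDerivAt (fun y : ℝ => (Complex.digamma y).re) (∑' k : ℕ, 1 / (x + k) ^ 2) x := by
    have h := hser.add_const (Complex.digamma (1 : ℝ)).re
    refine h.congr_of_eventuallyEq ?_
    filter_upwards [eventually_gt_nhds hx] with y hy
    rw [(hasSum_digamma_sub hy.le).tsum_eq]
    ring
  have hcpx : HasDerivAt (fun y : ℝ => Complex.digamma y)
      ((∑' k : ℕ, 1 / (x + k) ^ 2 : ℝ) : ℂ) x := by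
    refine hreal.ofReal_comp.congr_of_eventuallyEq ?_
    filter_upwards [eventually_gt_nhds hx0] with y hy
    rw [ofReal_re_digamma hy]
  -- Complex differentiability is needed separately: only then does the derivative along the real
  -- axis determine the complex one.
  have hdiff : DifferentiableAt ℂ Complex.digamma x := by
    have hU : IsOpen {s : ℂ | 0 < s.re} := isOpen_lt continuous_const Complex.continuous_re
    have hG : DifferentiableOn ℂ Complex.Gamma {s : ℂ | 0 < s.re} := fun s hs => by
      refine (Complex.differentiableAt_Gamma s fun m h => ?_).differentiableWithinAt
      have h1 : 0 < s.re := hs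
      rw [h] at h1
      simp at h1
      exact absurd h1 (not_lt.2 m.cast_nonneg)
    have hmem : {s : ℂ | 0 < s.re} ∈ nhds (x : ℂ) := hU.mem_nhds (by simpa using hx0)
    exact ((hG.deriv hU).differentiableAt hmem).div (hG.differentiableAt hmem)
      (Complex.Gamma_ne_zero_of_re_pos (by simpa using hx0))
  exact hdiff.hasDerivAt.comp_ofReal.unique hcpx

/-! ### Bounds for the kernel -/

/-- The real-valued kernel `∑ₖ (1 + u + k)⁻² - (1 + u)⁻¹`. -/
noncomputable def realTrigammaKernel (u : ℝ) : ℝ :=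
  ∑' k : ℕ, 1 / (1 + u + k) ^ 2 - 1 / (1 + u)

theorem trigammaKernel_eq {u : ℝ} (hu : 0 < u) :
    trigammaKernel u = (realTrigammaKernel u : ℂ) := by
  have h := deriv_digamma_ofReal (x := 1 + u) (by linarith)
  rw [trigammaKernel, realTrigammaKernel]
  push_cast at h ⊢
  rw [h]

theorem hasSum_one_div_sub_one_div {c : ℝ} (hc : 0 < c) :
    HasSum (fun k : ℕ => 1 / (c + k) - 1 / (c + k + 1)) (1 / c) := by
  rw [hasSum_iff_tendsto_nat_of_nonneg]
  · have hs (n : ℕ) : ∑ k ∈ Finset.range n, (1 / (c + k) - 1 / (c + k + 1))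
        = 1 / c - 1 / (c + n) := by
      have := Finset.sum_range_sub' (fun k : ℕ => 1 / (c + k)) n
      simpa [add_assoc] using this
    simp_rw [hs]
    conv => enter [3, 1]; rw [← sub_zero (1 / c)]
    refine tendsto_const_nhds.sub ?_
    simp_rw [one_div]
    exact (Filter.tendsto_atTop_add_const_left _ c tendsto_natCast_atTop_atTop).inv_tendsto_atTop
  · intro k
    have hk : (0 : ℝ) ≤ k := k.cast_nonneg
    exact sub_nonneg.2 (one_div_le_one_div_of_le (by positivity) (by linarith))

/-- With c = 1+u, compare (c+k)⁻² ≥ 1/((c+k)(c+k+1)), whose sum telescopes to 1/c. -/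
theorem realTrigammaKernel_nonneg {u : ℝ} (hu : 0 ≤ u) : 0 ≤ realTrigammaKernel u := by
  have h := hasSum_one_div_sub_one_div (c := 1 + u) (by positivity)
  refine sub_nonneg.2 (hasSum_le ?_ h (summable_one_div_add_sq (x := 1 + u) (by linarith)).hasSum)
  intro k
  have hk : (0 : ℝ) ≤ k := k.cast_nonneg
  rw [div_sub_div _ _ (by positivity) (by positivity),
    div_le_div_iff₀ (by positivity) (by positivity)]
  nlinarith [show 0 < 1 + u + k by positivity]

/-- Split off the term k = 0; the remaining terms (c+k+1)⁻² lie below the same telescoping series.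
-/
theorem realTrigammaKernel_le {u : ℝ} (hu : 0 ≤ u) : realTrigammaKernel u ≤ 1 / (1 + u) ^ 2 := by
  have h := hasSum_one_div_sub_one_div (c := 1 + u) (by positivity)
  have hs := summable_one_div_add_sq (x := 1 + u) (by linarith)
  rw [realTrigammaKernel, hs.tsum_eq_zero_add]
  have : ∑' k : ℕ, 1 / (1 + u + ((k + 1 : ℕ) : ℝ)) ^ 2 ≤ 1 / (1 + u) := by
    refine hasSum_le ?_ ((summable_nat_add_iff 1).2 hs).hasSum h
    intro k
    have hk : (0 : ℝ) ≤ k := k.cast_nonneg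
    push_cast
    rw [div_sub_div _ _ (by positivity) (by positivity),
      div_le_div_iff₀ (by positivity) (by positivity)]
    nlinarith [show 0 < 1 + u + k by positivity]
  simp only [Nat.cast_zero, add_zero]
  linarith

/-! ### Beta integrals and termwise integration -/

theorem integral_rpow_mul_one_sub_rpow {s b : ℝ} (hs : 0 < s) (hb : 0 < b) :
    IntegrableOn (fun x : ℝ => x ^ (s - 1) * (1 - x) ^ (b - 1)) (Ioo 0 1) ∧
    ∫ x in Ioo (0 : ℝ) 1, x ^ (s - 1) * (1 - x) ^ (b - 1)
      = Real.Gamma s * Real.Gamma b / Real.Gamma (s + b) := by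
  have hs' : 0 < (s : ℂ).re := by simpa using hs
  have hb' : 0 < (b : ℂ).re := by simpa using hb
  have heq : EqOn (fun x : ℝ => (x : ℂ) ^ ((s : ℂ) - 1) * (1 - (x : ℂ)) ^ ((b : ℂ) - 1))
      (fun x : ℝ => ((x ^ (s - 1) * (1 - x) ^ (b - 1) : ℝ) : ℂ)) (Ioo 0 1) := by
    intro x hx
    have h1 : 0 ≤ 1 - x := by linarith [hx.2]
    simp only
    push_cast [Complex.ofReal_cpow hx.1.le, Complex.ofReal_cpow h1]
    rfl
  have hint := Complex.betaIntegral_convergent hs' hb'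
  rw [intervalIntegrable_iff_integrableOn_Ioo_of_le zero_le_one] at hint
  have hval := Complex.betaIntegral_eq_Gamma_mul_div s b hs' hb'
  rw [Complex.betaIntegral, intervalIntegral.integral_of_le zero_le_one,
    integral_Ioc_eq_integral_Ioo, setIntegral_congr_fun measurableSet_Ioo heq,
    integral_complex_ofReal, ← Complex.ofReal_add, Complex.Gamma_ofReal, Complex.Gamma_ofReal,
    Complex.Gamma_ofReal] at hval
  refine ⟨?_, by exact_mod_cast hval⟩
  have h := (hint.congr_fun heq measurableSet_Ioo).re
  simpa [IntegrableOn] using h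

theorem image_div_one_add_Ioi : (fun t : ℝ => t / (1 + t)) '' Ioi 0 = Ioo 0 1 := by
  ext x
  constructor
  · rintro ⟨t, ht, rfl⟩
    have ht : 0 < t := ht
    exact ⟨by positivity, (div_lt_one (by positivity)).2 (by linarith)⟩
  · rintro ⟨h0, h1⟩
    have h2 : 0 < 1 - x := by linarith
    refine ⟨x / (1 - x), div_pos h0 h2, ?_⟩
    have : 1 + x / (1 - x) = 1 / (1 - x) := by field_simp; ring
    simp only [this]
    field_simp

/-- Substitute x = t/(1+t) in the Beta integral on (0, 1). -/
theorem integral_rpow_mul_one_add_rpow {s a : ℝ} (hs : 0 < s) (ha : s < a) :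
    IntegrableOn (fun t : ℝ => t ^ (s - 1) * (1 + t) ^ (-a)) (Ioi 0) ∧
    ∫ t in Ioi (0 : ℝ), t ^ (s - 1) * (1 + t) ^ (-a)
      = Real.Gamma s * Real.Gamma (a - s) / Real.Gamma a := by
  have hderiv (t : ℝ) (ht : t ∈ Ioi (0 : ℝ)) :
      HasDerivWithinAt (fun t : ℝ => t / (1 + t)) (1 / (1 + t) ^ 2) (Ioi 0) t := by
    have ht : 0 < t := ht
    have h := (hasDerivAt_id t).fun_div ((hasDerivAt_id t).const_add 1) (by positivity)
    have e : (1 * (1 + id t) - id t * 1) / (1 + id t) ^ 2 = 1 / (1 + t) ^ 2 := by simp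
    rw [e] at h
    exact h.hasDerivWithinAt
  have hinj : InjOn (fun t : ℝ => t / (1 + t)) (Ioi 0) := by
    intro x hx y hy h
    have hx : 0 < x := hx
    have hy : 0 < y := hy
    simp only at h
    rw [div_eq_div_iff (by positivity) (by positivity)] at h
    linarith
  have heq : EqOn (fun t : ℝ => |1 / (1 + t) ^ 2| •
        ((t / (1 + t)) ^ (s - 1) * (1 - t / (1 + t)) ^ (a - s - 1)))
      (fun t : ℝ => t ^ (s - 1) * (1 + t) ^ (-a)) (Ioi 0) := by
    intro t ht
    have ht : 0 < t := ht
    have h1 : 0 < 1 + t := by positivity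
    have e1 : 1 - t / (1 + t) = (1 + t)⁻¹ := by field_simp; ring
    have e2 : 1 / (1 + t) ^ 2 = (1 + t) ^ (-2 : ℝ) := by
      rw [Real.rpow_neg h1.le, one_div]; norm_cast
    simp only [smul_eq_mul]
    rw [abs_of_nonneg (by positivity), e1, e2, Real.div_rpow ht.le h1.le, Real.inv_rpow h1.le,
      ← Real.rpow_neg h1.le, div_eq_mul_inv, ← Real.rpow_neg h1.le]
    have : -a = -2 + (-(s - 1) + -(a - s - 1)) := by ring
    rw [this, Real.rpow_add h1, Real.rpow_add h1]
    ring
  obtain ⟨hint, hval⟩ := integral_rpow_mul_one_sub_rpow hs (sub_pos.2 ha)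
  rw [← image_div_one_add_Ioi] at hint hval
  rw [integrableOn_image_iff_integrableOn_abs_deriv_smul measurableSet_Ioi hderiv hinj] at hint
  rw [integral_image_eq_integral_abs_deriv_smul measurableSet_Ioi hderiv hinj,
    setIntegral_congr_fun measurableSet_Ioi heq, add_sub_cancel] at hval
  exact ⟨hint.congr_fun heq measurableSet_Ioi, hval⟩

theorem integral_rpow_mul_add_rpow {s a c : ℝ} (hs : 0 < s) (ha : s < a) (hc : 0 < c) :
    IntegrableOn (fun t : ℝ => t ^ (s - 1) * (c + t) ^ (-a)) (Ioi 0) ∧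
    ∫ t in Ioi (0 : ℝ), t ^ (s - 1) * (c + t) ^ (-a)
      = c ^ (s - a) * (Real.Gamma s * Real.Gamma (a - s) / Real.Gamma a) := by
  obtain ⟨hint, hval⟩ := integral_rpow_mul_one_add_rpow hs ha
  have hc' : 0 < c⁻¹ := inv_pos.2 hc
  have heq : EqOn (fun t : ℝ => (c⁻¹ * t) ^ (s - 1) * (1 + c⁻¹ * t) ^ (-a))
      (fun t : ℝ => c ^ (a - s + 1) * (t ^ (s - 1) * (c + t) ^ (-a))) (Ioi 0) := by
    intro t ht
    have ht : 0 < t := ht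
    have e : 1 + c⁻¹ * t = c⁻¹ * (c + t) := by field_simp
    simp only
    rw [e, Real.mul_rpow hc'.le ht.le, Real.mul_rpow hc'.le (by positivity), Real.inv_rpow hc.le,
      Real.inv_rpow hc.le, ← Real.rpow_neg hc.le, ← Real.rpow_neg hc.le]
    have : a - s + 1 = -(s - 1) + -(-a) := by ring
    rw [this, Real.rpow_add hc]
    ring
  have hne : c ^ (a - s + 1) ≠ 0 := (Real.rpow_pos_of_pos hc _).ne'
  constructor
  · have h := (integrableOn_Ioi_comp_mul_left_iff
      (fun t : ℝ => t ^ (s - 1) * (1 + t) ^ (-a)) 0 hc').2 (by simpa using hint)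
    have h2 := (h.congr_fun heq measurableSet_Ioi).const_mul (c ^ (a - s + 1))⁻¹
    exact IntegrableOn.congr_fun h2 (fun t _ => inv_mul_cancel_left₀ hne _) measurableSet_Ioi
  · have h := integral_comp_mul_left_Ioi
      (fun t : ℝ => t ^ (s - 1) * (1 + t) ^ (-a)) 0 hc'
    rw [setIntegral_congr_fun measurableSet_Ioi heq, mul_zero, hval, integral_const_mul, inv_inv,
      smul_eq_mul] at h
    have e : c ^ (a - s + 1) * c ^ (s - a) = c := by
      rw [← Real.rpow_add hc, show a - s + 1 + (s - a) = 1 by ring, Real.rpow_one]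
    refine mul_left_cancel₀ hne ?_
    rw [h, ← mul_assoc, e]

theorem integral_rpow_neg_mul_tsum {w : ℝ} (h0 : 0 < w) (h1 : w < 1) :
    ∫ u in Ioi (0 : ℝ), u ^ (-w) * ∑' k : ℕ, 1 / (1 + u + k) ^ 2
      = w * (Real.pi / Real.sin (Real.pi * w)) * ∑' k : ℕ, 1 / (1 + (k : ℝ)) ^ (1 + w) := by
  have hterm (k : ℕ) : IntegrableOn (fun u : ℝ => u ^ (-w) * (1 / (1 + u + k) ^ 2)) (Ioi 0) ∧
      ∫ u in Ioi (0 : ℝ), u ^ (-w) * (1 / (1 + u + k) ^ 2)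
        = w * (Real.pi / Real.sin (Real.pi * w)) * (1 / (1 + (k : ℝ)) ^ (1 + w)) := by
    have hk : (0 : ℝ) ≤ k := k.cast_nonneg
    have hc : (0 : ℝ) < 1 + k := by positivity
    obtain ⟨hint, hval⟩ := integral_rpow_mul_add_rpow (s := 1 - w) (a := 2) (c := 1 + k)
      (by linarith) (by linarith) hc
    have heq : EqOn (fun u : ℝ => u ^ (1 - w - 1) * (1 + (k : ℝ) + u) ^ (-2 : ℝ))
        (fun u : ℝ => u ^ (-w) * (1 / (1 + u + k) ^ 2)) (Ioi 0) := by
      intro u hu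
      have hu : 0 < u := hu
      simp only
      rw [show 1 - w - 1 = -w by ring, show 1 + (k : ℝ) + u = 1 + u + k by ring,
        Real.rpow_neg (by positivity), one_div]
      norm_cast
    refine ⟨hint.congr_fun heq measurableSet_Ioi, ?_⟩
    rw [← setIntegral_congr_fun measurableSet_Ioi heq, hval]
    have hG : Real.Gamma (2 - (1 - w)) = w * Real.Gamma w := by
      rw [← Real.Gamma_add_one h0.ne']
      ring_nf
    rw [hG, Real.Gamma_two, ← Real.Gamma_mul_Gamma_one_sub,
      show 1 - w - 2 = -(1 + w) by ring, Real.rpow_neg hc.le]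
    ring
  have hsum : Summable (fun k : ℕ => 1 / (1 + (k : ℝ)) ^ (1 + w)) := by
    have := (Real.summable_one_div_nat_add_rpow 1 (1 + w)).2 (by linarith)
    refine this.congr fun k => ?_
    rw [abs_of_nonneg (by positivity), add_comm]
  -- The terms are nonnegative, so summability of the integrals alone justifies the interchange.
  have h := hasSum_integral_of_summable_integral_norm (μ := volume.restrict (Ioi (0 : ℝ)))
    (F := fun (k : ℕ) (u : ℝ) => u ^ (-w) * (1 / (1 + u + k) ^ 2)) (fun k => (hterm k).1) ?_
  · simp_rw [fun k => (hterm k).2, tsum_mul_left] at h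
    exact h.unique (hsum.hasSum.mul_left _)
  · refine (hsum.mul_left (w * (Real.pi / Real.sin (Real.pi * w)))).congr fun k => ?_
    rw [← (hterm k).2]
    refine setIntegral_congr_fun measurableSet_Ioi fun u hu => ?_
    have hu : 0 < u := hu
    exact (Real.norm_of_nonneg (by positivity)).symm

theorem integral_rpow_neg_mul_one_div_one_add {w : ℝ} (h0 : 0 < w) (h1 : w < 1) :
    IntegrableOn (fun u : ℝ => u ^ (-w) * (1 / (1 + u))) (Ioi 0) ∧
    ∫ u in Ioi (0 : ℝ), u ^ (-w) * (1 / (1 + u)) = Real.pi / Real.sin (Real.pi * w) := by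
  obtain ⟨hint, hval⟩ := integral_rpow_mul_one_add_rpow (s := 1 - w) (a := 1)
    (by linarith) (by linarith)
  have heq : EqOn (fun u : ℝ => u ^ (1 - w - 1) * (1 + u) ^ (-1 : ℝ))
      (fun u : ℝ => u ^ (-w) * (1 / (1 + u))) (Ioi 0) := by
    intro u hu
    have hu : 0 < u := hu
    simp only
    rw [show 1 - w - 1 = -w by ring, Real.rpow_neg_one, one_div]
  refine ⟨hint.congr_fun heq measurableSet_Ioi, ?_⟩
  rw [← setIntegral_congr_fun measurableSet_Ioi heq, hval, sub_sub_cancel, Real.Gamma_one, div_one,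
    mul_comm, Real.Gamma_mul_Gamma_one_sub]

/-! ### Log moments and the Mellin transform of the kernel -/

theorem measurable_trigammaKernel : Measurable trigammaKernel := by
  have h : Measurable fun u : ℝ => (1 + (u : ℂ)) := by fun_prop
  exact ((measurable_deriv Complex.digamma).comp h).sub (measurable_const.div h)

theorem norm_trigammaKernel_le {u : ℝ} (hu : 0 < u) : ‖trigammaKernel u‖ ≤ 1 / (1 + u) ^ 2 := by
  rw [trigammaKernel_eq hu, Complex.norm_real,
    Real.norm_of_nonneg (realTrigammaKernel_nonneg hu.le)]
  exact realTrigammaKernel_le hu.le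

/-- The kernel multiplied by `(-log u)ʲ`. -/
noncomputable def logKernel (j : ℕ) (u : ℝ) : ℂ :=
  (-Real.log u : ℂ) ^ j * trigammaKernel u

theorem logKernel_succ (j : ℕ) :
    logKernel (j + 1) = fun u => -(Real.log u • logKernel j u) := by
  ext u
  simp only [logKernel, Complex.real_smul]
  ring

theorem logMomentIntegrand_eq (j : ℕ) : logMomentIntegrand j = logKernel j := by
  ext u
  rw [logMomentIntegrand, logKernel, neg_pow]
  ring

/-- The strict bound a < 2 leaves room at each induction step for a slightly larger exponent that
absorbs one more logarithm. -/
theorem logKernel_isBigO_atTop (j : ℕ) {a : ℝ} (ha : a < 2) :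
    logKernel j =O[Filter.atTop] (fun u : ℝ => u ^ (-a)) := by
  induction j generalizing a with
  | zero =>
    refine Asymptotics.IsBigO.of_bound 1 ?_
    filter_upwards [Filter.eventually_ge_atTop 1] with u hu
    have hu0 : 0 < u := by linarith
    rw [logKernel, pow_zero, one_mul, one_mul, Real.norm_of_nonneg (by positivity)]
    calc ‖trigammaKernel u‖ ≤ 1 / (1 + u) ^ 2 := norm_trigammaKernel_le hu0
      _ ≤ 1 / u ^ 2 := by gcongr; linarith
      _ = u ^ (-2 : ℝ) := by rw [Real.rpow_neg hu0.le, one_div]; norm_cast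
      _ ≤ u ^ (-a) := Real.rpow_le_rpow_of_exponent_le hu (by linarith)
  | succ j ih =>
    rw [logKernel_succ]
    obtain ⟨b, hab, hb⟩ := exists_between ha
    exact (isBigO_rpow_top_log_smul hab (ih hb)).neg_left

theorem logKernel_isBigO_zero (j : ℕ) {b : ℝ} (hb : 0 < b) :
    logKernel j =O[nhdsWithin 0 (Ioi 0)] (fun u : ℝ => u ^ (-b)) := by
  induction j generalizing b with
  | zero =>
    refine Asymptotics.IsBigO.of_bound 1 ?_
    filter_upwards [Ioo_mem_nhdsGT (zero_lt_one (α := ℝ))] with u hu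
    have hu0 : 0 < u := hu.1
    rw [logKernel, pow_zero, one_mul, one_mul, Real.norm_of_nonneg (by positivity)]
    calc ‖trigammaKernel u‖ ≤ 1 / (1 + u) ^ 2 := norm_trigammaKernel_le hu0
      _ ≤ 1 := by rw [div_le_one (by positivity)]; nlinarith
      _ ≤ u ^ (-b) := Real.one_le_rpow_of_pos_of_le_one_of_nonpos hu0 hu.2.le (by linarith)
  | succ j ih =>
    rw [logKernel_succ]
    obtain ⟨a, ha, hab⟩ := exists_between hb
    exact (isBigO_rpow_zero_log_smul hab (ih ha)).neg_left

theorem locallyIntegrableOn_logKernel (j : ℕ) : LocallyIntegrableOn (logKernel j) (Ioi 0) := by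
  rw [locallyIntegrableOn_iff isOpen_Ioi.isLocallyClosed]
  intro k hk hkc
  have hK : IntegrableOn trigammaKernel k := by
    refine Measure.integrableOn_of_bounded (M := 1) hkc.measure_lt_top.ne
      measurable_trigammaKernel.aestronglyMeasurable ?_
    refine ae_restrict_of_forall_mem hkc.measurableSet fun u hu => ?_
    have hu0 : 0 < u := hk hu
    refine (norm_trigammaKernel_le hu0).trans ?_
    rw [div_le_one (by positivity)]
    nlinarith
  refine hK.continuousOn_mul (fun u hu => ?_) hkc
  have hu0 : u ≠ 0 := (show 0 < u from hk hu).ne'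
  have hlog := Complex.continuous_ofReal.continuousAt.comp (Real.continuousAt_log hu0)
  exact (hlog.neg.pow j).continuousWithinAt

theorem mellinConvergent_logKernel (j : ℕ) {s : ℂ} (h0 : 0 < s.re) (h2 : s.re < 2) :
    MellinConvergent (logKernel j) s := by
  obtain ⟨a, ha, ha2⟩ := exists_between h2
  obtain ⟨b, hb0, hb⟩ := exists_between h0
  exact mellinConvergent_of_isBigO_rpow (locallyIntegrableOn_logKernel j)
    (logKernel_isBigO_atTop j ha2) ha (logKernel_isBigO_zero j hb0) hb

theorem integrableOn_logMomentIntegrand (j : ℕ) :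
    IntegrableOn (logMomentIntegrand j) (Ioi (0 : ℝ)) := by
  have h := mellinConvergent_logKernel j (s := 1) (by simp) (by simp)
  rw [logMomentIntegrand_eq]
  simpa [MellinConvergent] using h

/-- Differentiation under the integral; the sign from w ↦ 1 - w is why `logKernel` uses -log u. -/
theorem hasDerivAt_mellin_logKernel (j : ℕ) {w : ℂ} (h0 : -1 < w.re) (h1 : w.re < 1) :
    HasDerivAt (fun z => mellin (logKernel j) (1 - z)) (mellin (logKernel (j + 1)) (1 - w)) w := by
  have h0' : 0 < (1 - w).re := by simpa using h1
  have h2' : (1 - w).re < 2 := by simp; linarith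
  obtain ⟨a, ha, ha2⟩ := exists_between h2'
  obtain ⟨b, hb0, hb⟩ := exists_between h0'
  have h := (mellin_hasDerivAt_of_isBigO_rpow (locallyIntegrableOn_logKernel j)
    (logKernel_isBigO_atTop j ha2) ha (logKernel_isBigO_zero j hb0) hb).2
  have h2 := h.comp_const_sub 1 w
  have e : mellin (logKernel (j + 1)) (1 - w)
      = -mellin (fun t => Real.log t • logKernel j t) (1 - w) := by
    rw [logKernel_succ, mellin, mellin, ← integral_neg]
    simp
  rw [e]
  exact h2

theorem isOpen_strip : IsOpen {w : ℂ | -1 < w.re ∧ w.re < 1} :=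
  (isOpen_lt continuous_const Complex.continuous_re).inter
    (isOpen_lt Complex.continuous_re continuous_const)

theorem iteratedDeriv_mellin_trigammaKernel (j : ℕ) {w : ℂ} (h0 : -1 < w.re) (h1 : w.re < 1) :
    iteratedDeriv j (fun z => mellin trigammaKernel (1 - z)) w = mellin (logKernel j) (1 - w) := by
  induction j generalizing w with
  | zero => simp [show logKernel 0 = trigammaKernel from funext fun u => by simp [logKernel]]
  | succ j ih =>
    rw [iteratedDeriv_succ, ← (hasDerivAt_mellin_logKernel j h0 h1).deriv]
    refine Filter.EventuallyEq.deriv_eq ?_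
    filter_upwards [isOpen_strip.mem_nhds ⟨h0, h1⟩] with z hz using ih hz.1 hz.2

theorem analyticOnNhd_mellin_trigammaKernel :
    AnalyticOnNhd ℂ (fun z => mellin trigammaKernel (1 - z)) {w : ℂ | -1 < w.re ∧ w.re < 1} := by
  refine DifferentiableOn.analyticOnNhd (fun w hw => ?_) isOpen_strip
  have h := hasDerivAt_mellin_logKernel 0 hw.1 hw.2
  rw [show logKernel 0 = trigammaKernel from funext fun u => by simp [logKernel]] at h
  exact h.differentiableAt.differentiableWithinAt

/-! ### The zeta identity and its continuation -/

theorem mellin_trigammaKernel_ofReal {w : ℝ} (h0 : 0 < w) (h1 : w < 1) :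
    mellin trigammaKernel (1 - w)
      = (Real.pi / Complex.sin (Real.pi * w)) * (w * riemannZeta (1 + w) - 1) := by
  have heq : EqOn (fun u : ℝ => (u : ℂ) ^ ((1 : ℂ) - w - 1) • trigammaKernel u)
      (fun u : ℝ => ((u ^ (-w) * realTrigammaKernel u : ℝ) : ℂ)) (Ioi 0) := by
    intro u hu
    have hu : 0 < u := hu
    simp only [smul_eq_mul]
    rw [trigammaKernel_eq hu]
    push_cast [Complex.ofReal_cpow hu.le]
    ring_nf
  have hconv := mellinConvergent_logKernel 0 (s := 1 - w) (by simpa using h1)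
    (by simp; linarith)
  rw [show logKernel 0 = trigammaKernel from funext fun u => by simp [logKernel]] at hconv
  have hint : IntegrableOn (fun u : ℝ => u ^ (-w) * realTrigammaKernel u) (Ioi 0) := by
    have := (IntegrableOn.congr_fun hconv heq measurableSet_Ioi).re
    simpa [IntegrableOn] using this
  obtain ⟨hint', hval'⟩ := integral_rpow_neg_mul_one_div_one_add h0 h1
  have hsum := integral_rpow_neg_mul_tsum h0 h1
  have hadd := integral_add hint hint'
  have hcongr : ∫ u in Ioi (0 : ℝ), (u ^ (-w) * realTrigammaKernel u + u ^ (-w) * (1 / (1 + u)))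
      = ∫ u in Ioi (0 : ℝ), u ^ (-w) * ∑' k : ℕ, 1 / (1 + u + k) ^ 2 := by
    refine setIntegral_congr_fun measurableSet_Ioi fun u _ => ?_
    simp only [realTrigammaKernel]
    ring
  rw [hcongr, hsum, hval'] at hadd
  have hzeta : riemannZeta (1 + w) = ((∑' k : ℕ, 1 / (1 + (k : ℝ)) ^ (1 + w) : ℝ) : ℂ) := by
    rw [zeta_eq_tsum_one_div_nat_add_one_cpow (by simpa using h0), Complex.ofReal_tsum]
    refine tsum_congr fun k => ?_
    push_cast [Complex.ofReal_cpow (show (0 : ℝ) ≤ 1 + k by positivity)]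
    rw [add_comm (k : ℂ)]
  have hreal := eq_sub_of_add_eq hadd.symm
  rw [mellin, setIntegral_congr_fun measurableSet_Ioi heq, integral_complex_ofReal, hreal, hzeta]
  push_cast
  ring

theorem riemannZeta₁_one_add_eqOn :
    EqOn (fun w : ℂ => riemannZeta₁ (1 + w))
      (fun w : ℂ => 1 + (1 / Real.pi : ℂ) *
        (Complex.sin (Real.pi * w) * mellin trigammaKernel (1 - w)))
      {w : ℂ | -1 < w.re ∧ w.re < 1} := by
  have hconv : Convex ℝ {w : ℂ | -1 < w.re ∧ w.re < 1} :=
    (convex_halfSpace_re_gt (-1)).inter (convex_halfSpace_re_lt 1)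
  have hζ : Differentiable ℂ riemannZeta₁ :=
    ((differentiable_id.sub_const 1).mul differentiable_riemannZeta₀).const_add 1
  refine AnalyticOnNhd.eqOn_of_preconnected_of_frequently_eq (z₀ := 0) ?_ ?_
    hconv.isPreconnected (by simp) ?_
  · exact (hζ.comp (differentiable_id.const_add 1)).differentiableOn.analyticOnNhd isOpen_strip
  · have hsin : Differentiable ℂ fun w : ℂ => Complex.sin (Real.pi * w) := by fun_prop
    exact analyticOnNhd_const.add (analyticOnNhd_const.mul
      ((hsin.differentiableOn.analyticOnNhd isOpen_strip).mul analyticOnNhd_mellin_trigammaKernel))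
  -- The points 1/(n+2) lie in (0, 1), where the real identity applies, and accumulate at 0.
  · have htend : Filter.Tendsto (fun n : ℕ => ((1 / ((n : ℝ) + 2) : ℝ) : ℂ)) Filter.atTop
        (nhdsWithin 0 {0}ᶜ) := by
      refine tendsto_nhdsWithin_iff.2 ⟨?_, Filter.Eventually.of_forall fun n => ?_⟩
      · rw [← Complex.ofReal_zero]
        refine (Complex.continuous_ofReal.tendsto 0).comp ?_
        simp_rw [one_div]
        exact (Filter.tendsto_atTop_add_const_right _ 2
          tendsto_natCast_atTop_atTop).inv_tendsto_atTop
      · have : (1 / ((n : ℝ) + 2)) ≠ 0 := by positivity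
        exact Complex.ofReal_ne_zero.2 this
    refine htend.frequently (Filter.Eventually.frequently (Filter.Eventually.of_forall fun n => ?_))
    set w : ℝ := 1 / ((n : ℝ) + 2) with hw
    have hn : (0 : ℝ) ≤ n := n.cast_nonneg
    have h0 : 0 < w := by positivity
    have h1 : w < 1 := by rw [hw, div_lt_one (by positivity)]; linarith
    have hsin : Complex.sin (Real.pi * w) ≠ 0 := by
      have := Real.sin_pos_of_pos_of_lt_pi (x := Real.pi * w) (by positivity)
        (by nlinarith [Real.pi_pos])
      have h2 := Complex.ofReal_ne_zero.2 this.ne'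
      push_cast at h2
      exact h2
    have hpi : (Real.pi : ℂ) ≠ 0 := Complex.ofReal_ne_zero.2 Real.pi_ne_zero
    have hw0 : (w : ℂ) ≠ 0 := Complex.ofReal_ne_zero.2 h0.ne'
    rw [mellin_trigammaKernel_ofReal h0 h1,
      riemannZeta_eq_inv_sub_mul (s := 1 + (w : ℂ)) (by simpa using hw0),
      add_sub_cancel_left]
    generalize Complex.sin (Real.pi * w) = S at hsin ⊢
    field_simp
    ring

/-! ### Taylor coefficients at s = 1 -/

theorem iteratedDeriv_complex_sin_zero (m : ℕ) :
    iteratedDeriv m Complex.sin 0 = Complex.sin (m * Real.pi / 2) := by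
  obtain ⟨k, rfl | rfl⟩ := m.even_or_odd'
  · rw [Complex.iteratedDeriv_even_sin]
    have : ((2 * k : ℕ) : ℂ) * Real.pi / 2 = k * Real.pi := by push_cast; ring
    rw [this, Complex.sin_nat_mul_pi]
    simp
  · rw [Complex.iteratedDeriv_odd_sin]
    have : ((2 * k + 1 : ℕ) : ℂ) * Real.pi / 2 = Real.pi / 2 + k * Real.pi := by push_cast; ring
    rw [this, Complex.sin_add, Complex.sin_nat_mul_pi, Complex.sin_pi_div_two]
    rw [Pi.mul_apply, Complex.cos_zero, ← Complex.ofReal_natCast, ← Complex.ofReal_mul,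
      ← Complex.ofReal_cos, Real.cos_nat_mul_pi]
    simp

theorem iteratedDeriv_riemannZeta₁_one {n : ℕ} (hn : 1 ≤ n) :
    iteratedDeriv n riemannZeta₁ 1 = logMomentSum n := by
  have hmem : (0 : ℂ) ∈ {w : ℂ | -1 < w.re ∧ w.re < 1} := by simp
  have hev := riemannZeta₁_one_add_eqOn.eventuallyEq_of_mem (isOpen_strip.mem_nhds hmem)
  have hl := congrFun (iteratedDeriv_comp_const_add n riemannZeta₁ 1) 0
  rw [add_zero] at hl
  have hsin : ContDiff ℂ n fun w : ℂ => Complex.sin (Real.pi * w) := by fun_prop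
  have hM : ContDiffAt ℂ n (fun w : ℂ => mellin trigammaKernel (1 - w)) 0 :=
    (analyticOnNhd_mellin_trigammaKernel 0 hmem).contDiffAt
  have hpi : (Real.pi : ℂ) ≠ 0 := Complex.ofReal_ne_zero.2 Real.pi_ne_zero
  rw [← hl, hev.iteratedDeriv_eq n, iteratedDeriv_const_add (by omega),
    iteratedDeriv_const_mul _ (hsin.contDiffAt.mul hM)]
  simp_rw [mul_comm (Complex.sin _)]
  rw [iteratedDeriv_fun_mul hM hsin.contDiffAt, logMomentSum, Finset.mul_sum]
  refine Finset.sum_congr rfl fun j hj => ?_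
  have hj : j ≤ n := by simpa [Nat.lt_succ_iff] using hj
  have hs := congrFun (iteratedDeriv_comp_const_mul (n := n - j) Complex.contDiff_sin Real.pi) 0
  simp only [mul_zero, iteratedDeriv_complex_sin_zero] at hs
  -- The chain rule gives π^(n-j); the prefactor 1/π lowers it to the integer power n-j-1.
  rw [iteratedDeriv_mellin_trigammaKernel j hmem.1 hmem.2, hs, logMomentIntegrand_eq, mellin, Nat.cast_sub hj, zpow_sub_one₀ hpi, ← Nat.cast_sub hj,
    ← Int.ofNat_sub hj, zpow_natCast]
  simp only [sub_zero, sub_self, Complex.cpow_zero, one_smul]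
  push_cast [hj]
  ring

theorem iteratedDeriv_riemannZeta₁_eq {n : ℕ} (hn : 1 ≤ n) :
    iteratedDeriv n riemannZeta₁ 1 = n * iteratedDeriv (n - 1) riemannZeta₀ 1 := by
  obtain ⟨m, rfl⟩ := Nat.exists_eq_add_of_le' hn
  have h0 : ContDiff ℂ (m + 1 : ℕ) riemannZeta₀ := differentiable_riemannZeta₀.contDiff
  have h1 : ContDiff ℂ (m + 1 : ℕ) fun s : ℂ => s - 1 := by fun_prop
  have hd : deriv (fun s : ℂ => s - 1) = fun _ => 1 := by ext s; simp
  change iteratedDeriv (m + 1) (fun s => 1 + (s - 1) * riemannZeta₀ s) 1 = _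
  -- Only the Leibniz term with one derivative on s - 1 survives: s - 1 vanishes at 1 and its higher
  -- derivatives are zero.
  rw [iteratedDeriv_const_add (by omega), iteratedDeriv_fun_mul h1.contDiffAt h0.contDiffAt,
    Finset.sum_eq_single_of_mem 1 (by simp)]
  · simp
  · intro i _ hi
    rcases i with _ | _ | i
    · simp
    · exact absurd rfl hi
    · rw [iteratedDeriv_succ', hd, iteratedDeriv_const]
      simp

theorem mainTheorem7 :
    (∀ j : ℕ, IntegrableOn (logMomentIntegrand j) (Ioi (0 : ℝ))) ∧
    ∀ n : ℕ, 1 ≤ n →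
      (-1 : ℂ) ^ (n - 1) * (n : ℂ) * stieltjesConstant (n - 1) = logMomentSum n ∧
      iteratedDeriv n (Function.update (fun s : ℂ => (s - 1) * riemannZeta s) 1 1) 1
        = logMomentSum n := by
  refine ⟨integrableOn_logMomentIntegrand, fun n hn => ⟨?_, ?_⟩⟩
  · rw [← iteratedDeriv_riemannZeta₁_one hn, iteratedDeriv_riemannZeta₁_eq hn, stieltjesConstant]
    have h1 : ((-1 : ℂ) ^ (n - 1)) * (-1) ^ (n - 1) = 1 := by rw [← mul_pow]; simp
    linear_combination (n * iteratedDeriv (n - 1) riemannZeta₀ 1) * h1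
  · have : Function.update (fun s : ℂ => (s - 1) * riemannZeta s) 1 1 = riemannZeta₁ := by
      ext s
      by_cases hs : s = 1
      · simp [hs, riemannZeta₁]
      · rw [Function.update_of_ne hs, riemannZeta_eq_inv_sub_mul hs,
          mul_inv_cancel_left₀ (sub_ne_zero.2 hs)]
    rw [this, iteratedDeriv_riemannZeta₁_one hn]
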